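/- **Setting.** Let $(\mathcal X,\mu)$ be a $\sigma$-finite measure space (for instance a Borel subset of $\mathbb R^d$ with a $\sigma$-finite Borel measure), $\Theta\subseteq\mathbb R^l$, $\mathcal S\subseteq\mathbb R^q$, $\psi:\Theta\to\mathbb R$, $\phi:\Theta\to\mathbb R^q$, and $S=(S_1,\dots,S_q):\mathcal X\to\mathcal S$ measurable (M1). Put $$L(s;\theta)=\psi(\theta)+\langle s,\phi(\theta)\rangle,\quad h(z;\theta)=e^{L(S(z);\theta)},\quad g(\theta)=\int h(z;\theta)\,\mu(dz),\quad p_\theta(z)=\frac{h(z;\theta)}{g(\theta)},\quad \bar S(\theta)=\int S\,p_\theta\,d\mu .$$ Assume (M2): (a) $\psi,\phi$ are continuous on $\Theta$; (b) for every $\theta\in\Theta$ the integral $\bar S(\theta)$ converges absolutely and lies in $\mathcal S$, and $\bar S$ is continuous on $\Theta$; (c) $\hat\theta:\mathcal S\to\Theta$ is a continuous function with $L(s;\hat\theta(s))=\sup_{\theta\in\Theta}L(s;\theta)$ for all $s\in\mathcal S$; (d) $g$ is positive, finite and continuous on $\Theta$, and $\{\theta\in\Theta: g(\theta)\ge M\}$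 is compact for every $M>0$. Let $\mathcal L=\{\theta\in\Theta:\hat\theta(\bar S(\theta))=\theta\}$ be the set of stationary points of the exact EM map. Assume (M3): either $g(\mathcal L)$ is compact, or $g(\mathcal L\cap K)$ is finite for every compact $K\subseteq\Theta$. Assume moreover that for every compact $K\subseteq\Theta$ there is $\varepsilon>0$ such that, for all $\alpha\in\overline{\mathcal B}(1,\varepsilon)$ and all $u\in\{1,\dots,q\}$, $$\sup_{\theta\in K}\int p_\theta^{\alpha}\,d\mu<\infty\qquad\text{and}\qquad \sup_{\theta\in K}\int S_u^2\,p_\theta^{\alpha}\,d\mu<\infty .$$ **Tempered EM.** Let $T_n>0$ with $T_n\to1$, and set $$\tilde p_{\theta,n}=\frac{p_\theta^{1/T_n}}{\int p_\theta^{1/T_n}\,d\mu},\qquad \tilde S_n(\theta)=\int S\,\tilde p_{\theta,n}\,d\mu,\qquad F_n(\theta)=\hat\theta(\tilde S_n(\theta)).$$ Let $(K_n)_{n\ge0}$ be an increasing sequence of compact sets with $\bigcup_nK_n=\Theta$, such that every compact subset of $\Theta$ is contained in some $K_n$ (for instance $K_n\subseteq\operatorname{int}_\Theta K_{n+1}$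 for all $n$). Let $(\theta_n,p_n)_{n\ge 0}$ be a run of the stable tempered EM: $\theta_0\in K_0$, $p_0=0$, and for every $n$ the E-step is well defined at $\theta_n$ (the integrals defining $\tilde p_{\theta_n,n}$ and $\tilde S_n(\theta_n)$ converge absolutely, and $\tilde S_n(\theta_n)\in\mathcal S$) and $$(\theta_{n+1},p_{n+1})=\begin{cases}(F_n(\theta_n),\,p_n)&\text{if }F_n(\theta_n)\in K_{p_n},\\(\theta_0,\,p_n+1)&\text{otherwise.}\end{cases}$$ **Conclusion.** For every compact $K\subseteq\Theta$, $$\sup_{\theta\in K}\int\Big(\frac{\tilde p_{\theta,n}}{p_\theta}-1\Big)^2p_\theta\,d\mu\;\longrightarrow\;0\qquad(n\to\infty).$$ Moreover, writing $\mathrm{Cl}$ for the closure of $\{\theta_n:n\ge0\}$, for every such run: (i) (a) $\limsup_n p_n<\infty$, and $\mathrm{Cl}$ is a compact subset of $\Theta$; (b) $(g(\theta_n))_n$ converges towards a connected component of $g(\mathcal L\cap\mathrm{Cl})\subseteq g(\mathcal L)$ (the distance of $g(\theta_n)$ to that component tends to $0$); (ii) if $g(\mathcal L\cap\mathrm{Cl})$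 has empty interior, then there is $g^*\in\mathbb R$ such that $g(\theta_n)\to g^*$ and $(\theta_n)_n$ converges towards the nonempty set $\{\theta\in\mathcal L:g(\theta)=g^*\}\cap\mathrm{Cl}$ (the distance of $\theta_n$ to it tends to $0$). -/

import Mathlib

open MeasureTheory Filter Topology Set
open scoped ENNReal

/-- The data of a curved exponential model on a measurable space `X` of latent values: a reference
measure `μ`, a parameter set `Θ ⊆ ℝ^l`, functions `ψ : Θ → ℝ`, `φ : Θ → ℝ^q`, and a sufficient
statistic `S : X → Sdom ⊆ ℝ^q`.  (Functions on `Θ` or `Sdom` are total functions on the ambient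
space, of which only the values on `Θ`, resp. `Sdom`, are ever used.) -/
structure ExpModel (l q : ℕ) (X : Type*) [MeasurableSpace X] where
  μ : Measure X
  Θ : Set (EuclideanSpace ℝ (Fin l))
  Sdom : Set (EuclideanSpace ℝ (Fin q))
  ψ : EuclideanSpace ℝ (Fin l) → ℝ
  φ : EuclideanSpace ℝ (Fin l) → EuclideanSpace ℝ (Fin q)
  S : X → EuclideanSpace ℝ (Fin q)

namespace ExpModel

variable {l q : ℕ} {X : Type*} [MeasurableSpace X]

/-- `L(s; θ) = ψ(θ) + ⟨s, φ(θ)⟩`. -/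
noncomputable def logLik (M : ExpModel l q X) (s : EuclideanSpace ℝ (Fin q))
    (θ : EuclideanSpace ℝ (Fin l)) : ℝ :=
  M.ψ θ + inner ℝ s (M.φ θ)

/-- The complete likelihood `h(z; θ) = exp (L(S(z); θ))`. -/
noncomputable def h (M : ExpModel l q X) (z : X) (θ : EuclideanSpace ℝ (Fin l)) : ℝ :=
  Real.exp (M.logLik (M.S z) θ)

/-- The observed likelihood `g(θ) = ∫ h(z; θ) μ(dz)`. -/
noncomputable def g (M : ExpModel l q X) (θ : EuclideanSpace ℝ (Fin l)) : ℝ :=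
  ∫ z, M.h z θ ∂M.μ

/-- The conditional density `p_θ(z) = h(z; θ) / g(θ)`. -/
noncomputable def dens (M : ExpModel l q X) (θ : EuclideanSpace ℝ (Fin l)) (z : X) : ℝ :=
  M.h z θ / M.g θ

/-- The exact E-step: `S̄(θ) = ∫ S(z) p_θ(z) μ(dz)`. -/
noncomputable def Sbar (M : ExpModel l q X) (θ : EuclideanSpace ℝ (Fin l)) :
    EuclideanSpace ℝ (Fin q) :=
  ∫ z, M.dens θ z • M.S z ∂M.μ

/-- The normalised tempered density `p_θ(z)^(1/T) / ∫ p_θ(z')^(1/T) μ(dz')`. -/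
noncomputable def temperedDens (M : ExpModel l q X) (T : ℝ) (θ : EuclideanSpace ℝ (Fin l))
    (z : X) : ℝ :=
  M.dens θ z ^ (1 / T) / ∫ z', M.dens θ z' ^ (1 / T) ∂M.μ

/-- The tempered E-step: the mean of `S` under the normalised tempered density. -/
noncomputable def temperedS (M : ExpModel l q X) (T : ℝ) (θ : EuclideanSpace ℝ (Fin l)) :
    EuclideanSpace ℝ (Fin q) :=
  ∫ z, M.temperedDens T θ z • M.S z ∂M.μ

/-- The tempered E-step at temperature `T` makes sense at `θ`: the integrals that define it
converge, and its value lies in the domain `Sdom` of the M-step. -/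
structure TemperedStepDefined (M : ExpModel l q X) (T : ℝ)
    (θ : EuclideanSpace ℝ (Fin l)) : Prop where
  integrable_pow : Integrable (fun z => M.dens θ z ^ (1 / T)) M.μ
  integrable_stat : Integrable (fun z => M.temperedDens T θ z • M.S z) M.μ
  mem_Sdom : M.temperedS T θ ∈ M.Sdom

/-- Condition M1. -/
structure CondM1 (M : ExpModel l q X) : Prop where
  sigmaFinite : SigmaFinite M.μ
  measurable_S : Measurable M.S
  S_mem : ∀ z, M.S z ∈ M.Sdom

/-- Condition M2, for the M-step `θhat : Sdom → Θ`. -/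
structure CondM2 (M : ExpModel l q X)
    (θhat : EuclideanSpace ℝ (Fin q) → EuclideanSpace ℝ (Fin l)) : Prop where
  /-- (a) `ψ` and `φ` are continuous on `Θ` -/
  continuousOn_ψ : ContinuousOn M.ψ M.Θ
  continuousOn_φ : ContinuousOn M.φ M.Θ
  /-- (b) `S̄` is finite, continuous on `Θ`, and takes its values in the domain of the M-step -/
  integrable_Sbar : ∀ θ ∈ M.Θ, Integrable (fun z => M.dens θ z • M.S z) M.μ
  continuousOn_Sbar : ContinuousOn M.Sbar M.Θ
  Sbar_mem : ∀ θ ∈ M.Θ, M.Sbar θ ∈ M.Sdom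
  /-- (c) `θhat : Sdom → Θ` is continuous and `θhat s` maximises `L(s; ·)` over `Θ` -/
  mapsTo_θhat : MapsTo θhat M.Sdom M.Θ
  continuousOn_θhat : ContinuousOn θhat M.Sdom
  isMaxOn_θhat : ∀ s ∈ M.Sdom, IsMaxOn (M.logLik s) M.Θ (θhat s)
  /-- (d) `g` is finite, positive, continuous on `Θ`, with compact superlevel sets -/
  integrable_h : ∀ θ ∈ M.Θ, Integrable (fun z => M.h z θ) M.μ
  g_pos : ∀ θ ∈ M.Θ, 0 < M.g θ
  continuousOn_g : ContinuousOn M.g M.Θ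
  isCompact_level : ∀ c : ℝ, 0 < c → IsCompact {θ ∈ M.Θ | c ≤ M.g θ}

/-- The set of stationary points of the exact EM map `θhat ∘ S̄`. -/
def statPoints (M : ExpModel l q X)
    (θhat : EuclideanSpace ℝ (Fin q) → EuclideanSpace ℝ (Fin l)) :
    Set (EuclideanSpace ℝ (Fin l)) :=
  {θ ∈ M.Θ | θhat (M.Sbar θ) = θ}

/-- Condition M3: either `g(ℒ)` is compact, or `g(ℒ ∩ K)` is finite for all compact `K ⊆ Θ`. -/
def CondM3 (M : ExpModel l q X)
    (θhat : EuclideanSpace ℝ (Fin q) → EuclideanSpace ℝ (Fin l)) : Prop :=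
  IsCompact (M.g '' M.statPoints θhat) ∨
    ∀ K ⊆ M.Θ, IsCompact K → (M.g '' (M.statPoints θhat ∩ K)).Finite

/-- For every compact `K ⊆ Θ` there is `ε > 0` such that, for all `α` in the closed ball of centre
`1` and radius `ε`, the integrals of `p_θ^α` and of `S_u² p_θ^α` are bounded over `θ ∈ K`. -/
def TemperingCond (M : ExpModel l q X) : Prop :=
  ∀ K ⊆ M.Θ, IsCompact K → ∃ ε : ℝ, 0 < ε ∧ ∀ α ∈ Metric.closedBall (1 : ℝ) ε,
    (⨆ θ ∈ K, ∫⁻ z, ENNReal.ofReal (M.dens θ z ^ α) ∂M.μ) < ∞ ∧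
    ∀ u : Fin q, (⨆ θ ∈ K, ∫⁻ z, ENNReal.ofReal ((M.S z u) ^ 2 * M.dens θ z ^ α) ∂M.μ) < ∞

end ExpModel

/-- `K 0 ⊆ K 1 ⊆ …` is an exhaustion of `Θ` by compact sets: their union is `Θ`, and every compact
subset of `Θ` is contained in one of them. -/
structure IsCompactExhaustion {E : Type*} [TopologicalSpace E] (Θ : Set E) (K : ℕ → Set E) :
    Prop where
  isCompact : ∀ n, IsCompact (K n)
  monotone : Monotone K
  iUnion_eq : ⋃ n, K n = Θ
  exists_subset : ∀ C ⊆ Θ, IsCompact C → ∃ n, C ⊆ K n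

/-- `θ` is the sequence of iterates, and `p` the sequence of restart counters, of the stabilised
iteration of the maps `F n` with truncation sets `K n`: a step that leaves `K (p n)` is rejected,
and the iteration restarts from `θ 0` with the next truncation set. -/
structure IsStableIteration {E : Type*} (K : ℕ → Set E) (F : ℕ → E → E)
    (θ : ℕ → E) (p : ℕ → ℕ) : Prop where
  init_mem : θ 0 ∈ K 0
  init_count : p 0 = 0
  accept : ∀ n, F n (θ n) ∈ K (p n) → θ (n + 1) = F n (θ n) ∧ p (n + 1) = p n
  reject : ∀ n, F n (θ n) ∉ K (p n) → θ (n + 1) = θ 0 ∧ p (n + 1) = p n + 1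

/-- The sequence `u` converges towards the set `A`: `dist (u n, A) → 0`.  The distance to the empty
set is `∞`, so this forces `A` to be nonempty. -/
def ConvergesToSet {E : Type*} [PseudoEMetricSpace E] (u : ℕ → E) (A : Set E) : Prop :=
  Tendsto (fun n => Metric.infEDist (u n) A) atTop (𝓝 0)

/-!
Write `G θ = θhat (S̄ θ)` for the exact EM map. Since `Δ + 1 ≤ exp Δ`, applied to the log-likelihood
ratio `Δ` of two parameters and integrated against `p_θ`, a parameter that does not decrease
`L(S̄ θ; ·)` does not decrease `g`, and equality in `g` forces equality of the densities. Hence `g`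
increases along `G`, and strictly so unless `G θ` is stationary.

Convexity of `α ↦ p_θ(z)^α` bounds `|∫ p_θ^α dμ - 1|` by a multiple of `|α - 1|`, uniformly on
compact sets. The `χ²`-divergence of the tempered density from `p_θ` only involves such integrals,
so it tends to zero uniformly on compact sets; by the Cauchy–Schwarz inequality the tempered E-steps
are then asymptotic to the exact ones.

For the dynamics, choose a positive level `c ≤ g (θ 0)` that is not a stationary value. By
compactness, the set `{g ≥ c}` is eventually preserved by the perturbed maps, so restarts
cease: otherwise a late restart at `θ 0` would be trapped in `{g ≥ c}` and never be followed by
another. Afterwards the orbit is precompact, and at every value between the lower and the upper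
limit of `g (θ n)` there are steps along which `g` does not increase much; their limits are
stationary, so the whole interval consists of stationary values.
-/

theorem limsup_natCast_lt_top {p : ℕ → ℕ} {P : ℕ} (hP : ∀ n, p n ≤ P) :
    limsup (fun n => (p n : ℕ∞)) atTop < ⊤ :=
  (limsup_le_of_le ⟨0, by simp⟩ (.of_forall fun n => Nat.cast_le.2 (hP n))).trans_lt
    (ENat.natCast_lt_top P)

theorem convergesToSet_of_mapClusterPt_mem {E : Type*} [PseudoEMetricSpace E] {u : ℕ → E}
    {A C : Set E} (hC : IsCompact C) (hu : ∀ n, u n ∈ C)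
    (hA : ∀ x, MapClusterPt x atTop u → x ∈ A) : ConvergesToSet u A := by
  refine (tendsto_iff_ultrafilter _ _ _).2 fun U hU => ?_
  obtain ⟨x, -, hx⟩ := hC.ultrafilter_le_nhds (U.map u) (tendsto_principal.2 (.of_forall hu))
  have hxA : x ∈ A := hA x (mapClusterPt_iff_ultrafilter.2 ⟨U, hU, hx⟩)
  have hedist : Tendsto (fun n => edist (u n) x) U (𝓝 0) := tendsto_iff_edist_tendsto_0.1 hx
  exact tendsto_of_tendsto_of_tendsto_of_le_of_le tendsto_const_nhds hedist (fun _ => zero_le)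
    fun _ => Metric.infEDist_le_edist_of_mem hxA

theorem subsingleton_of_ordConnected_of_interior_eq_empty {α : Type*} [LinearOrder α]
    [TopologicalSpace α] [OrderClosedTopology α] [DenselyOrdered α] {s : Set α}
    (hs : s.OrdConnected) (hint : interior s = ∅) : s.Subsingleton := by
  refine not_nontrivial_iff.1 fun hs' => ?_
  obtain ⟨a, ha, b, hb, hab⟩ := hs'.exists_lt
  have hIoo := interior_maximal (Ioo_subset_Icc_self.trans (hs.out ha hb)) isOpen_Ioo
  exact ((nonempty_Ioo.2 hab).mono hIoo).ne_empty hint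

section LimitInterval

variable {α : Type*} [LinearOrder α] {u : ℕ → α}

/-- The interval between the lower and the upper limit of a sequence `u`, described without
reference to `liminf` and `limsup`, which take junk values on unbounded sequences. -/
def limitInterval (u : ℕ → α) : Set α :=
  {m | (∀ a < m, ∃ᶠ n in atTop, a < u n) ∧ ∀ b > m, ∃ᶠ n in atTop, u n < b}

theorem ordConnected_limitInterval (u : ℕ → α) : (limitInterval u).OrdConnected :=
  ordConnected_iff.2 fun _ hx _ hy _ _ hm =>
    ⟨fun a ha => hy.1 a (ha.trans_le hm.2), fun b hb => hx.2 b (hm.1.trans_lt hb)⟩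

theorem mem_limitInterval_of_mapClusterPt [TopologicalSpace α] [OrderTopology α] {m : α}
    (hm : MapClusterPt m atTop u) : m ∈ limitInterval u :=
  ⟨fun _ ha => hm.frequently (Ioi_mem_nhds ha), fun _ hb => hm.frequently (Iio_mem_nhds hb)⟩

theorem frequently_lt_and_succ_lt {a b : α} (hab : a < b) (ha : ∃ᶠ n in atTop, a < u n)
    (hb : ∃ᶠ n in atTop, u n < b) : ∃ᶠ n in atTop, a < u n ∧ u (n + 1) < b := by
  refine frequently_atTop.2 fun N => ?_
  by_contra! hjump
  obtain ⟨k, hNk, hk⟩ := frequently_atTop.1 ha N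
  have hstay : ∀ n ≥ k, a < u n := fun n hn => by
    induction n, hn using Nat.le_induction with
    | base => exact hk
    | succ n hkn hn => exact hab.trans_le (hjump n (hNk.trans hkn) hn)
  obtain ⟨n, hkn, hn⟩ := frequently_atTop.1 hb (k + 1)
  obtain ⟨n, rfl⟩ := Nat.exists_eq_add_of_le' (le_of_add_le_right hkn)
  exact hn.not_ge (hjump n (by omega) (hstay n (by omega)))

theorem exists_subseq_of_mem_limitInterval {u : ℕ → ℝ} {m : ℝ} (hm : m ∈ limitInterval u) :
    ∃ φ : ℕ → ℕ, StrictMono φ ∧ (∀ a < m, ∀ᶠ j in atTop, a < u (φ j)) ∧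
      ∀ b > m, ∀ᶠ j in atTop, u (φ j + 1) < b := by
  obtain ⟨δ, -, hδ, hδ0⟩ := exists_seq_strictAnti_tendsto (0 : ℝ)
  obtain ⟨φ, hφ, hu⟩ := extraction_forall_of_frequently fun j =>
    frequently_lt_and_succ_lt (a := m - δ j) (b := m + δ j) (by linarith [hδ j])
      (hm.1 _ (by linarith [hδ j])) (hm.2 _ (by linarith [hδ j]))
  refine ⟨φ, hφ, fun a ha => ?_, fun b hb => ?_⟩
  · filter_upwards [hδ0.eventually_lt_const (sub_pos.2 ha)] with j hj
    linarith [(hu j).1]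
  · filter_upwards [hδ0.eventually_lt_const (sub_pos.2 hb)] with j hj
    linarith [(hu j).2]

theorem exists_convergesToSet_connectedComponentIn {u : ℕ → ℝ} {A C : Set ℝ} (hC : IsCompact C)
    (hu : ∀ n, u n ∈ C) (hA : limitInterval u ⊆ A) :
    ∃ w ∈ A, ConvergesToSet u (connectedComponentIn A w) := by
  obtain ⟨w, -, hw⟩ := hC.exists_mapClusterPt (f := atTop) (tendsto_principal.2 (.of_forall hu))
  have hw := mem_limitInterval_of_mapClusterPt hw
  exact ⟨w, hA hw, convergesToSet_of_mapClusterPt_mem hC hu fun x hx =>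
    (ordConnected_limitInterval u).isPreconnected.subset_connectedComponentIn hw hA
      (mem_limitInterval_of_mapClusterPt hx)⟩

theorem exists_tendsto_of_interior_eq_empty {u : ℕ → ℝ} {A C : Set ℝ} (hC : IsCompact C)
    (hu : ∀ n, u n ∈ C) (hA : limitInterval u ⊆ A) (hint : interior A = ∅) :
    ∃ w, Tendsto u atTop (𝓝 w) := by
  obtain ⟨w, -, hw⟩ := hC.exists_mapClusterPt (f := atTop) (tendsto_principal.2 (.of_forall hu))
  have hsub := subsingleton_of_ordConnected_of_interior_eq_empty (ordConnected_limitInterval u)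
    (subset_empty_iff.1 (hint ▸ interior_mono hA))
  exact ⟨w, hC.tendsto_nhds_of_unique_mapClusterPt (.of_forall hu) fun x _ hx =>
    hsub (mem_limitInterval_of_mapClusterPt hx) (mem_limitInterval_of_mapClusterPt hw)⟩

end LimitInterval

section AscentMap

variable {E : Type*} [TopologicalSpace E] {Θ C : Set E} {G : E → E} {g : E → ℝ} {u v : ℕ → E}

/-- `G` is a self-map of `Θ` along which the continuous objective `g` increases, strictly so unless
the image point is already fixed by `G`. -/
structure IsAscentMap (Θ : Set E) (G : E → E) (g : E → ℝ) : Prop where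
  mapsTo : MapsTo G Θ Θ
  continuousOn : ContinuousOn g Θ
  le_map : ∀ x ∈ Θ, g x ≤ g (G x)
  fixed_of_eq : ∀ x ∈ Θ, g (G x) = g x → G (G x) = G x

/-- The sequence `v` is asymptotically the image of `u` under `G`: for `x ∈ Θ`, as `n → ∞` while
`u n → x`, also `v n → G x`. Stating it with a single filter covers subsequences and ultrafilters
alike. -/
def TracksMap (Θ : Set E) (G : E → E) (u v : ℕ → E) : Prop :=
  ∀ x ∈ Θ, Tendsto v (atTop ⊓ comap u (𝓝 x)) (𝓝 (G x))

theorem TracksMap.congr' {w : ℕ → E} (hv : TracksMap Θ G u v) (hvw : v =ᶠ[atTop] w) :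
    TracksMap Θ G u w := fun x hx => (hv x hx).congr' (hvw.filter_mono inf_le_left)

theorem IsAscentMap.exists_mapClusterPt_fixed (h : IsAscentMap Θ G g) (huv : TracksMap Θ G u v)
    {l : Filter ℕ} [l.NeBot] (hl : l ≤ atTop) (hC : IsCompact C) (hCΘ : C ⊆ Θ)
    (hu : ∀ᶠ n in l, u n ∈ C) (hv : ∀ᶠ n in l, v n ∈ Θ) {m : ℝ}
    (hgu : ∀ a < m, ∀ᶠ n in l, a < g (u n)) (hgv : ∀ b > m, ∀ᶠ n in l, g (v n) < b) :
    ∃ y ∈ {x ∈ Θ | G x = x}, g y = m ∧ MapClusterPt y l v := by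
  obtain ⟨x, hxC, hx⟩ := hC.exists_mapClusterPt (le_principal_iff.2 hu)
  obtain ⟨U, hUl, hUu⟩ := mapClusterPt_iff_ultrafilter.1 hx
  have hxΘ := hCΘ hxC
  have hUv : Tendsto v U (𝓝 (G x)) :=
    (huv x hxΘ).mono_left (le_inf (hUl.trans hl) (tendsto_iff_comap.1 hUu))
  have hUgu : Tendsto (fun n => g (u n)) U (𝓝 (g x)) := (h.continuousOn x hxΘ).tendsto.comp
    (tendsto_nhdsWithin_iff.2 ⟨hUu, (hu.filter_mono hUl).mono fun _ hn => hCΘ hn⟩)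
  have hUgv : Tendsto (fun n => g (v n)) U (𝓝 (g (G x))) :=
    (h.continuousOn _ (h.mapsTo hxΘ)).tendsto.comp
      (tendsto_nhdsWithin_iff.2 ⟨hUv, hv.filter_mono hUl⟩)
  have hm : m ≤ g x := le_of_forall_lt_imp_le_of_dense fun a ha =>
    ge_of_tendsto hUgu (((hgu a ha).filter_mono hUl).mono fun _ hn => hn.le)
  have hm' : g (G x) ≤ m := le_of_forall_gt_imp_ge_of_dense fun b hb =>
    le_of_tendsto hUgv (((hgv b hb).filter_mono hUl).mono fun _ hn => hn.le)
  have hle := h.le_map x hxΘ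
  exact ⟨G x, ⟨h.mapsTo hxΘ, h.fixed_of_eq x hxΘ (by linarith)⟩, by linarith,
    mapClusterPt_iff_ultrafilter.2 ⟨U, hUl, hUv⟩⟩

theorem IsAscentMap.eventually_mem_superlevel (h : IsAscentMap Θ G g) (huv : TracksMap Θ G u v)
    (hv : ∀ n, v n ∈ Θ) {c : ℝ} (hcomp : IsCompact {x ∈ Θ | c ≤ g x})
    (hc : c ∉ g '' {x ∈ Θ | G x = x}) :
    ∀ᶠ n in atTop, u n ∈ {x ∈ Θ | c ≤ g x} → v n ∈ {x ∈ Θ | c ≤ g x} := by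
  by_contra hleave
  set bad := {n | ¬(u n ∈ {x ∈ Θ | c ≤ g x} → v n ∈ {x ∈ Θ | c ≤ g x})}
  have : (atTop ⊓ 𝓟 bad).NeBot := frequently_mem_iff_neBot.1 (not_eventually.1 hleave)
  have hbad : ∀ᶠ n in atTop ⊓ 𝓟 bad, u n ∈ {x ∈ Θ | c ≤ g x} ∧ g (v n) < c := by
    filter_upwards [mem_inf_of_right (mem_principal_self bad)] with n hn
    obtain ⟨hun, hvn⟩ := Classical.not_imp.1 hn
    exact ⟨hun, not_le.1 fun hle => hvn ⟨hv n, hle⟩⟩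
  obtain ⟨y, hy, hgy, -⟩ := h.exists_mapClusterPt_fixed huv inf_le_left hcomp (sep_subset _ _)
    (hbad.mono fun n hn => hn.1) (.of_forall hv)
    (fun a ha => hbad.mono fun n hn => ha.trans_le hn.1.2)
    (fun b hb => hbad.mono fun n hn => hn.2.trans hb)
  exact hc ⟨y, hy, hgy⟩

theorem IsAscentMap.limitInterval_subset (h : IsAscentMap Θ G g)
    (htrack : TracksMap Θ G u fun n => u (n + 1)) (hC : IsCompact (closure (range u)))
    (hCΘ : closure (range u) ⊆ Θ) :
    limitInterval (fun n => g (u n)) ⊆ g '' ({x ∈ Θ | G x = x} ∩ closure (range u)) := by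
  intro m hm
  have hmem : ∀ n, u n ∈ closure (range u) := fun n => subset_closure (mem_range_self n)
  obtain ⟨φ, hφ, hgt, hlt⟩ := exists_subseq_of_mem_limitInterval hm
  obtain ⟨y, hy, hgy, hyu⟩ := h.exists_mapClusterPt_fixed (l := map φ atTop) htrack
    hφ.tendsto_atTop hC hCΘ (.of_forall hmem) (.of_forall fun n => hCΘ (hmem (n + 1))) hgt hlt
  exact ⟨y, ⟨hy, isClosed_closure.mem_of_mapClusterPt hyu (.of_forall fun n => hmem (n + 1))⟩, hgy⟩

end AscentMap

theorem IsAscentMap.convergesToSet {E : Type*} [EMetricSpace E] {Θ : Set E} {G : E → E} {g : E → ℝ}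
    {u : ℕ → E} (h : IsAscentMap Θ G g) (htrack : TracksMap Θ G u fun n => u (n + 1))
    (hC : IsCompact (closure (range u))) (hCΘ : closure (range u) ⊆ Θ) {w : ℝ}
    (hw : Tendsto (fun n => g (u n)) atTop (𝓝 w)) :
    ConvergesToSet u ({x ∈ {x ∈ Θ | G x = x} | g x = w} ∩ closure (range u)) := by
  have hmem : ∀ n, u n ∈ closure (range u) := fun n => subset_closure (mem_range_self n)
  refine (tendsto_add_atTop_iff_nat 1).1 <|
    convergesToSet_of_mapClusterPt_mem hC (fun n => hmem (n + 1)) fun x hx => ?_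
  obtain ⟨U, hU, hUx⟩ := mapClusterPt_iff_ultrafilter.1 hx
  obtain ⟨y, hy, hgy, hyu⟩ := h.exists_mapClusterPt_fixed htrack hU hC hCΘ (.of_forall hmem)
    (.of_forall fun n => hCΘ (hmem (n + 1)))
    (fun a ha => hU (hw.eventually_const_lt ha))
    (fun b hb => hU (((tendsto_add_atTop_iff_nat 1).2 hw).eventually_lt_const hb))
  obtain rfl : y = x := eq_of_nhds_neBot (hyu.neBot.mono (inf_le_inf_left _ hUx))
  exact ⟨⟨hy, hgy⟩, isClosed_closure.mem_of_mapClusterPt hyu (.of_forall fun n => hmem (n + 1))⟩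

namespace IsStableIteration

variable {E : Type*} {K : ℕ → Set E} {F : ℕ → E → E} {θ : ℕ → E} {p : ℕ → ℕ}
  (h : IsStableIteration K F θ p)
include h

theorem monotone_count : Monotone p := by
  refine monotone_nat_of_le_succ fun n => ?_
  by_cases hn : F n (θ n) ∈ K (p n)
  · exact (h.accept n hn).2.ge
  · exact (h.reject n hn).2 ▸ Nat.le_succ _

theorem mem_truncation (hK : Monotone K) (n : ℕ) : θ n ∈ K (p n) := by
  induction n with
  | zero => rw [h.init_count]; exact h.init_mem
  | succ n _ =>
    by_cases hn : F n (θ n) ∈ K (p n)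
    · rwa [(h.accept n hn).1, (h.accept n hn).2]
    · exact (h.reject n hn).1 ▸ hK (Nat.zero_le _) h.init_mem

theorem tendsto_count_atTop (hrej : ∃ᶠ n in atTop, F n (θ n) ∉ K (p n)) :
    Tendsto p atTop atTop := by
  refine tendsto_atTop_atTop_of_monotone h.monotone_count fun b => ?_
  induction b with
  | zero => exact ⟨0, Nat.zero_le _⟩
  | succ b ih =>
    obtain ⟨k, hk⟩ := ih
    obtain ⟨n, hkn, hn⟩ := frequently_atTop.1 hrej k
    exact ⟨n + 1, (h.reject n hn).2 ▸ Nat.succ_le_succ (hk.trans (h.monotone_count hkn))⟩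

theorem accept_of_invariant (hK : Monotone K) {W : Set E} {k : ℕ} (hW : W ⊆ K (p k))
    (hstep : ∀ n ≥ k, θ n ∈ W → F n (θ n) ∈ W) (hk : θ k ∈ W) {n : ℕ} (hn : k ≤ n) :
    F n (θ n) ∈ K (p n) := by
  have hacc : ∀ n ≥ k, θ n ∈ W → F n (θ n) ∈ K (p n) := fun n hn hθ =>
    hK (h.monotone_count hn) (hW (hstep n hn hθ))
  have hmem : θ n ∈ W := by
    induction n, hn using Nat.le_induction with
    | base => exact hk
    | succ n hn ih => exact (h.accept n (hacc n hn ih)).1 ▸ hstep n hn ih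
  exact hacc n hn hmem

theorem eventually_accept (hK : Monotone K) {W : Set E} {N : ℕ} (hW : W ⊆ K N) (h0 : θ 0 ∈ W)
    (hstep : ∀ᶠ n in atTop, θ n ∈ W → F n (θ n) ∈ W) : ∀ᶠ n in atTop, F n (θ n) ∈ K (p n) := by
  by_contra hrej
  rw [not_eventually] at hrej
  obtain ⟨n₀, hn₀⟩ := eventually_atTop.1 (hstep.and
    ((h.tendsto_count_atTop hrej).eventually_ge_atTop N))
  obtain ⟨k, hk, hreject⟩ := frequently_atTop.1 hrej n₀
  obtain ⟨n, hn, hreject'⟩ := frequently_atTop.1 hrej (k + 1)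
  exact hreject' <| h.accept_of_invariant hK (hW.trans (hK (hn₀ (k + 1) (by omega)).2))
    (fun j hj => (hn₀ j (by omega)).1) ((h.reject k hreject).1 ▸ h0) hn

theorem exists_count_le (hacc : ∀ᶠ n in atTop, F n (θ n) ∈ K (p n)) : ∃ P, ∀ n, p n ≤ P := by
  obtain ⟨n₀, hn₀⟩ := eventually_atTop.1 hacc
  refine ⟨p n₀, fun n => ?_⟩
  rcases le_total n n₀ with hn | hn
  · exact h.monotone_count hn
  · induction n, hn using Nat.le_induction with
    | base => rfl
    | succ n hn ih => exact (h.accept n (hn₀ n hn)).2.trans_le ih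

theorem closure_range_subset [TopologicalSpace E] [T2Space E] {Θ : Set E}
    (hK : IsCompactExhaustion Θ K) {P : ℕ} (hP : ∀ n, p n ≤ P) : closure (range θ) ⊆ K P :=
  closure_minimal (range_subset_iff.2 fun n => hK.monotone (hP n) (h.mem_truncation hK.monotone n))
    (hK.isCompact P).isClosed

end IsStableIteration

theorem IsAscentMap.eventually_accept {E : Type*} [TopologicalSpace E] {Θ : Set E} {G : E → E}
    {g : E → ℝ} {K : ℕ → Set E} {F : ℕ → E → E} {θ : ℕ → E} {p : ℕ → ℕ} (h : IsAscentMap Θ G g)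
    (hK : IsCompactExhaustion Θ K) (hrun : IsStableIteration K F θ p)
    (htrack : TracksMap Θ G θ fun n => F n (θ n)) (hF : ∀ n, F n (θ n) ∈ Θ) {c : ℝ}
    (hcomp : IsCompact {x ∈ Θ | c ≤ g x}) (hc : c ∉ g '' {x ∈ Θ | G x = x}) (hc0 : c ≤ g (θ 0)) :
    ∀ᶠ n in atTop, F n (θ n) ∈ K (p n) := by
  obtain ⟨N, hN⟩ := hK.exists_subset _ (sep_subset _ _) hcomp
  have h0 : θ 0 ∈ Θ := hK.iUnion_eq ▸ mem_iUnion_of_mem 0 hrun.init_mem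
  exact hrun.eventually_accept hK.monotone hN ⟨h0, hc0⟩
    (h.eventually_mem_superlevel htrack hF hcomp hc)

namespace ExpModel

variable {l q : ℕ} {X : Type*} [MeasurableSpace X] {M : ExpModel l q X}

section Ascent

variable {θ θ' : EuclideanSpace ℝ (Fin l)}

theorem integrable_h_of_g_pos (hg : 0 < M.g θ) : Integrable (fun z => M.h z θ) M.μ :=
  .of_integral_ne_zero hg.ne'

theorem dens_pos (hg : 0 < M.g θ) (z : X) : 0 < M.dens θ z := div_pos (Real.exp_pos _) hg

theorem integrable_dens (hg : 0 < M.g θ) : Integrable (M.dens θ) M.μ :=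
  (integrable_h_of_g_pos hg).div_const _

theorem integral_dens (hg : 0 < M.g θ) : ∫ z, M.dens θ z ∂M.μ = 1 :=
  (integral_div _ _).trans (div_self hg.ne')

/-- The log-likelihood ratio `log (h(z; θ') / h(z; θ))` of two parameters at the point `z`. -/
noncomputable def logRatio (M : ExpModel l q X) (θ θ' : EuclideanSpace ℝ (Fin l)) (z : X) : ℝ :=
  M.logLik (M.S z) θ' - M.logLik (M.S z) θ

theorem dens_mul_exp_logRatio (θ θ' : EuclideanSpace ℝ (Fin l)) (z : X) :
    M.dens θ z * Real.exp (M.logRatio θ θ' z) = M.h z θ' / M.g θ := by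
  rw [dens, h, h, logRatio, div_mul_eq_mul_div, ← Real.exp_add, add_sub_cancel]

theorem dens_mul_logRatio (θ θ' : EuclideanSpace ℝ (Fin l)) (z : X) :
    M.dens θ z * M.logRatio θ θ' z =
      M.dens θ z * (M.ψ θ' - M.ψ θ) + inner ℝ (M.φ θ' - M.φ θ) (M.dens θ z • M.S z) := by
  simp only [logRatio, logLik, inner_smul_right, real_inner_comm (M.S z), inner_sub_right]
  ring

theorem integrable_dens_mul_logRatio (hg : 0 < M.g θ)
    (hS : Integrable (fun z => M.dens θ z • M.S z) M.μ) :
    Integrable (fun z => M.dens θ z * M.logRatio θ θ' z) M.μ := by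
  simp only [dens_mul_logRatio]
  exact ((integrable_dens hg).mul_const _).add (hS.const_inner _)

theorem integral_dens_mul_logRatio (hg : 0 < M.g θ)
    (hS : Integrable (fun z => M.dens θ z • M.S z) M.μ) :
    ∫ z, M.dens θ z * M.logRatio θ θ' z ∂M.μ =
      M.logLik (M.Sbar θ) θ' - M.logLik (M.Sbar θ) θ := by
  simp only [dens_mul_logRatio]
  rw [integral_add ((integrable_dens hg).mul_const _) (hS.const_inner _), integral_mul_const,
    integral_dens hg, integral_inner hS, ← Sbar]
  simp only [logLik, real_inner_comm (M.Sbar θ), inner_sub_right]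
  ring

theorem integrable_dens_mul_add_one (hg : 0 < M.g θ)
    (hS : Integrable (fun z => M.dens θ z • M.S z) M.μ) :
    Integrable (fun z => M.dens θ z * (M.logRatio θ θ' z + 1)) M.μ := by
  simp only [mul_add_one]
  exact (integrable_dens_mul_logRatio hg hS).add (integrable_dens hg)

theorem integral_dens_mul_add_one (hg : 0 < M.g θ)
    (hS : Integrable (fun z => M.dens θ z • M.S z) M.μ) :
    ∫ z, M.dens θ z * (M.logRatio θ θ' z + 1) ∂M.μ =
      M.logLik (M.Sbar θ) θ' - M.logLik (M.Sbar θ) θ + 1 := by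
  simp only [mul_add_one]
  rw [integral_add (integrable_dens_mul_logRatio hg hS) (integrable_dens hg),
    integral_dens_mul_logRatio hg hS, integral_dens hg]

theorem integrable_dens_mul_exp_logRatio (hg' : 0 < M.g θ') :
    Integrable (fun z => M.dens θ z * Real.exp (M.logRatio θ θ' z)) M.μ := by
  simp only [dens_mul_exp_logRatio]
  exact (integrable_h_of_g_pos hg').div_const _

theorem integral_dens_mul_exp_logRatio (θ θ' : EuclideanSpace ℝ (Fin l)) :
    ∫ z, M.dens θ z * Real.exp (M.logRatio θ θ' z) ∂M.μ = M.g θ' / M.g θ := by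
  simp only [dens_mul_exp_logRatio]
  exact integral_div _ _

theorem dens_mul_add_one_le_dens_mul_exp (hg : 0 < M.g θ) (z : X) :
    M.dens θ z * (M.logRatio θ θ' z + 1) ≤ M.dens θ z * Real.exp (M.logRatio θ θ' z) :=
  mul_le_mul_of_nonneg_left (Real.add_one_le_exp _) (dens_pos hg z).le

theorem g_le_of_logLik_le (hg : 0 < M.g θ) (hg' : 0 < M.g θ')
    (hS : Integrable (fun z => M.dens θ z • M.S z) M.μ)
    (hL : M.logLik (M.Sbar θ) θ ≤ M.logLik (M.Sbar θ) θ') : M.g θ ≤ M.g θ' := by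
  have hmono := integral_mono (integrable_dens_mul_add_one hg hS)
    (integrable_dens_mul_exp_logRatio hg') (dens_mul_add_one_le_dens_mul_exp hg)
  rw [integral_dens_mul_add_one hg hS, integral_dens_mul_exp_logRatio] at hmono
  exact (one_le_div₀ hg).1 (by linarith)

theorem logRatio_ae_eq_zero (hg : 0 < M.g θ) (hgg : M.g θ' = M.g θ)
    (hS : Integrable (fun z => M.dens θ z • M.S z) M.μ)
    (hL : M.logLik (M.Sbar θ) θ ≤ M.logLik (M.Sbar θ) θ') : M.logRatio θ θ' =ᵐ[M.μ] 0 := by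
  have hi := integrable_dens_mul_add_one (θ' := θ') hg hS
  have hi' := integrable_dens_mul_exp_logRatio (θ := θ) (hgg ▸ hg : 0 < M.g θ')
  have hle := dens_mul_add_one_le_dens_mul_exp (θ' := θ') hg
  have hint : ∫ z, M.dens θ z * (M.logRatio θ θ' z + 1) ∂M.μ =
      ∫ z, M.dens θ z * Real.exp (M.logRatio θ θ' z) ∂M.μ := by
    refine (integral_mono hi hi' hle).antisymm ?_
    rw [integral_dens_mul_add_one hg hS, integral_dens_mul_exp_logRatio, hgg, div_self hg.ne']
    linarith
  filter_upwards [(integral_eq_iff_of_ae_le hi hi' (.of_forall hle)).1 hint] with z hz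
  by_contra hne
  exact (Real.add_one_lt_exp hne).ne (mul_left_cancel₀ (dens_pos hg z).ne' hz)

theorem Sbar_eq_of_g_eq (hg : 0 < M.g θ) (hgg : M.g θ' = M.g θ)
    (hS : Integrable (fun z => M.dens θ z • M.S z) M.μ)
    (hL : M.logLik (M.Sbar θ) θ ≤ M.logLik (M.Sbar θ) θ') : M.Sbar θ' = M.Sbar θ := by
  refine integral_congr_ae ?_
  filter_upwards [logRatio_ae_eq_zero hg hgg hS hL] with z hz
  simp only [dens, h, hgg, sub_eq_zero.1 hz]

end Ascent

section EMMap

variable {θhat : EuclideanSpace ℝ (Fin q) → EuclideanSpace ℝ (Fin l)}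
  {θ : EuclideanSpace ℝ (Fin l)}

theorem CondM2.isAscentMap (hM2 : M.CondM2 θhat) :
    IsAscentMap M.Θ (fun t => θhat (M.Sbar t)) M.g := by
  have hmaps : MapsTo (fun t => θhat (M.Sbar t)) M.Θ M.Θ :=
    fun t ht => hM2.mapsTo_θhat (hM2.Sbar_mem t ht)
  have hmax : ∀ t ∈ M.Θ, M.logLik (M.Sbar t) t ≤ M.logLik (M.Sbar t) (θhat (M.Sbar t)) :=
    fun t ht => hM2.isMaxOn_θhat _ (hM2.Sbar_mem t ht) ht
  exact
    { mapsTo := hmaps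
      continuousOn := hM2.continuousOn_g
      le_map := fun t ht => g_le_of_logLik_le (hM2.g_pos t ht) (hM2.g_pos _ (hmaps ht))
        (hM2.integrable_Sbar t ht) (hmax t ht)
      fixed_of_eq := fun t ht hgg => congrArg θhat <|
        Sbar_eq_of_g_eq (hM2.g_pos t ht) hgg (hM2.integrable_Sbar t ht) (hmax t ht) }

theorem CondM2.exists_level_notMem (hM2 : M.CondM2 θhat) (hM3 : M.CondM3 θhat) (hθ : θ ∈ M.Θ) :
    ∃ c, 0 < c ∧ c ≤ M.g θ ∧ c ∉ M.g '' M.statPoints θhat := by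
  have hg := hM2.g_pos θ hθ
  by_contra! hmem
  have hIoc : Ioc 0 (M.g θ) ⊆ M.g '' M.statPoints θhat := fun c hc => hmem c hc.1 hc.2
  rcases hM3 with hcompact | hfinite
  · obtain ⟨x, hx, hgx⟩ : (0 : ℝ) ∈ M.g '' M.statPoints θhat := by
      refine hcompact.isClosed.closure_subset_iff.2 hIoc ?_
      rw [closure_Ioc hg.ne]
      exact left_mem_Icc.2 hg.le
    exact (hM2.g_pos x hx.1).ne' hgx
  · refine Icc_infinite (half_lt_self hg) <| (hfinite _ (fun _ hx => hx.1)
      (hM2.isCompact_level _ (half_pos hg))).subset fun c hc => ?_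
    obtain ⟨x, hx, rfl⟩ := hIoc ⟨(half_pos hg).trans_le hc.1, hc.2⟩
    exact ⟨x, ⟨hx, hx.1, hc.1⟩, rfl⟩

end EMMap

end ExpModel

section Escort

theorem add_sub_le_of_convexOn {φ : ℝ → ℝ} (hφ : ConvexOn ℝ univ φ) (hφ0 : ∀ x, 0 ≤ φ x)
    (a : ℝ) {t ε : ℝ} (hε : 0 < ε) (ht : |t| ≤ ε) :
    φ (a + t) - φ a ≤ |t| / ε * (φ (a + ε) + φ (a - ε)) := by
  obtain ⟨δ, hδ, hδt⟩ : ∃ δ, φ (a + δ) ≤ φ (a + ε) + φ (a - ε) ∧ |t| / ε * δ = t := by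
    rcases abs_choice t with ht' | ht' <;> rw [ht']
    · exact ⟨ε, le_add_of_nonneg_right (hφ0 _), div_mul_cancel₀ _ hε.ne'⟩
    · refine ⟨-ε, by simpa only [← sub_eq_add_neg] using le_add_of_nonneg_left (hφ0 _), ?_⟩
      rw [neg_div, neg_mul_neg, div_mul_cancel₀ _ hε.ne']
  have hs0 : 0 ≤ |t| / ε := by positivity
  have hs1 : |t| / ε ≤ 1 := (div_le_one hε).2 ht
  calc φ (a + t) - φ a = φ ((1 - |t| / ε) • a + (|t| / ε) • (a + δ)) - φ a := by
        rw [smul_eq_mul, smul_eq_mul, mul_add, hδt]; ring_nf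
    _ ≤ (1 - |t| / ε) • φ a + (|t| / ε) • φ (a + δ) - φ a := by
        gcongr
        exact hφ.2 (mem_univ _) (mem_univ _) (sub_nonneg.2 hs1) hs0 (sub_add_cancel _ _)
    _ = |t| / ε * φ (a + δ) - |t| / ε * φ a := by simp only [smul_eq_mul]; ring
    _ ≤ |t| / ε * (φ (a + ε) + φ (a - ε)) :=
        (sub_le_self _ (mul_nonneg hs0 (hφ0 a))).trans (by gcongr)

theorem abs_add_sub_le_of_convexOn {φ : ℝ → ℝ} (hφ : ConvexOn ℝ univ φ) (hφ0 : ∀ x, 0 ≤ φ x)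
    (a : ℝ) {t ε : ℝ} (hε : 0 < ε) (ht : |t| ≤ ε) :
    |φ (a + t) - φ a| ≤ |t| / ε * (φ (a + ε) + φ (a - ε)) := by
  have hplus := add_sub_le_of_convexOn hφ hφ0 a hε ht
  have hminus := add_sub_le_of_convexOn hφ hφ0 a hε (abs_neg t ▸ ht)
  have hmid := hφ.2 (mem_univ (a + t)) (mem_univ (a + -t)) one_half_pos.le one_half_pos.le
    (add_halves 1)
  rw [show (1 / 2 : ℝ) • (a + t) + (1 / 2 : ℝ) • (a + -t) = a by simp only [smul_eq_mul]; ring,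
    smul_eq_mul, smul_eq_mul] at hmid
  rw [abs_neg] at hminus
  exact abs_le.2 ⟨by linarith, hplus⟩

theorem abs_rpow_sub_self_le {x : ℝ} (hx : 0 < x) {α ε : ℝ} (hε : 0 < ε) (hα : |α - 1| ≤ ε) :
    |x ^ α - x| ≤ |α - 1| / ε * (x ^ (1 + ε) + x ^ (1 - ε)) := by
  have h := abs_add_sub_le_of_convexOn (convexOn_rpow_left hx)
    (fun a => Real.rpow_nonneg hx.le a) 1 hε hα
  rwa [add_sub_cancel, Real.rpow_one] at h

variable {X : Type*} [MeasurableSpace X] {μ : Measure X}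

/-- The `χ²`-divergence `∫ (r / p - 1)² p dμ` of the density `r` from the density `p`. -/
noncomputable def chiSqDiv (μ : Measure X) (r p : X → ℝ) : ℝ≥0∞ :=
  ∫⁻ z, ENNReal.ofReal ((r z / p z - 1) ^ 2 * p z) ∂μ

/-- The escort density of order `β` of a density `f`, that is, the normalized power of `f`. The
tempered density at temperature `T` is the escort density of order `1 / T`. -/
noncomputable def escort (μ : Measure X) (β : ℝ) (f : X → ℝ) (z : X) : ℝ :=
  f z ^ β / ∫ y, f y ^ β ∂μ

variable {f : X → ℝ} {α β ε : ℝ}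

theorem integrable_rpow_sub_self (hf : ∀ z, 0 < f z) (hf1 : Integrable f μ) (hε : 0 < ε)
    (hplus : Integrable (fun z => f z ^ (1 + ε)) μ) (hminus : Integrable (fun z => f z ^ (1 - ε)) μ)
    (hα : |α - 1| ≤ ε) : Integrable (fun z => f z ^ α - f z) μ :=
  ((hplus.add hminus).const_mul (|α - 1| / ε)).mono'
    ((hf1.aemeasurable.pow_const α).sub hf1.aemeasurable).aestronglyMeasurable
    (Eventually.of_forall fun z => abs_rpow_sub_self_le (hf z) hε hα)

theorem integrable_rpow_of_abs_sub_one_le (hf : ∀ z, 0 < f z) (hf1 : Integrable f μ) (hε : 0 < ε)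
    (hplus : Integrable (fun z => f z ^ (1 + ε)) μ) (hminus : Integrable (fun z => f z ^ (1 - ε)) μ)
    (hα : |α - 1| ≤ ε) : Integrable (fun z => f z ^ α) μ :=
  ((integrable_rpow_sub_self hf hf1 hε hplus hminus hα).add hf1).congr
    (.of_forall fun _ => sub_add_cancel _ _)

theorem abs_integral_rpow_sub_integral_le (hf : ∀ z, 0 < f z) (hf1 : Integrable f μ) (hε : 0 < ε)
    (hplus : Integrable (fun z => f z ^ (1 + ε)) μ) (hminus : Integrable (fun z => f z ^ (1 - ε)) μ)
    (hα : |α - 1| ≤ ε) :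
    |∫ z, f z ^ α ∂μ - ∫ z, f z ∂μ| ≤
      |α - 1| / ε * (∫ z, f z ^ (1 + ε) ∂μ + ∫ z, f z ^ (1 - ε) ∂μ) := by
  have hdom : Integrable (fun z => |α - 1| / ε * (f z ^ (1 + ε) + f z ^ (1 - ε))) μ :=
    (hplus.add hminus).const_mul _
  rw [← integral_sub (integrable_rpow_of_abs_sub_one_le hf hf1 hε hplus hminus hα) hf1,
    ← integral_add hplus hminus, ← integral_const_mul]
  exact norm_integral_le_of_norm_le (f := fun z => f z ^ α - f z) hdom
    (.of_forall fun z => abs_rpow_sub_self_le (hf z) hε hα)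

theorem escort_div_sub_one_sq_mul (hf : ∀ z, 0 < f z) (hZ : ∫ y, f y ^ β ∂μ ≠ 0) (z : X) :
    (escort μ β f z / f z - 1) ^ 2 * f z = f z ^ (2 * β - 1) / (∫ y, f y ^ β ∂μ) ^ 2 -
      2 / (∫ y, f y ^ β ∂μ) * f z ^ β + f z := by
  have hz := hf z
  rw [escort, Real.rpow_sub hz, Real.rpow_one, two_mul, Real.rpow_add hz]
  field_simp
  ring

theorem chiSqDiv_escort (hf : ∀ z, 0 < f z) (hf1 : ∫ z, f z ∂μ = 1)
    (hβ : Integrable (fun z => f z ^ β) μ) (hβ' : Integrable (fun z => f z ^ (2 * β - 1)) μ)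
    (hZ : ∫ y, f y ^ β ∂μ ≠ 0) :
    chiSqDiv μ (escort μ β f) f = ENNReal.ofReal
      ((∫ z, f z ^ (2 * β - 1) ∂μ) / (∫ z, f z ^ β ∂μ) ^ 2 - 1) := by
  have hfi : Integrable f μ := .of_integral_ne_zero (hf1 ▸ one_ne_zero)
  have hsq := hβ'.div_const ((∫ y, f y ^ β ∂μ) ^ 2)
  have hcross := hβ.const_mul (2 / ∫ y, f y ^ β ∂μ)
  have hdiff : Integrable (fun z => f z ^ (2 * β - 1) / (∫ y, f y ^ β ∂μ) ^ 2 -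
      2 / (∫ y, f y ^ β ∂μ) * f z ^ β) μ := hsq.sub hcross
  have hint : Integrable (fun z => (escort μ β f z / f z - 1) ^ 2 * f z) μ := by
    simp only [escort_div_sub_one_sq_mul hf hZ]
    exact hdiff.add hfi
  rw [chiSqDiv, ← ofReal_integral_eq_lintegral_ofReal hint
    (.of_forall fun z => mul_nonneg (sq_nonneg _) (hf z).le)]
  simp only [escort_div_sub_one_sq_mul hf hZ]
  rw [integral_add hdiff hfi, integral_sub hsq hcross, integral_div, integral_const_mul, hf1,
    div_mul_cancel₀ _ hZ]
  ring_nf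

theorem chiSqDiv_escort_le (hf : ∀ z, 0 < f z) (hf1 : ∫ z, f z ∂μ = 1)
    (hβ : Integrable (fun z => f z ^ β) μ) (hβ' : Integrable (fun z => f z ^ (2 * β - 1)) μ)
    {a : ℝ} (ha : a < 1) (hle : |∫ z, f z ^ β ∂μ - 1| ≤ a)
    (hle' : |∫ z, f z ^ (2 * β - 1) ∂μ - 1| ≤ 2 * a) :
    chiSqDiv μ (escort μ β f) f ≤ ENNReal.ofReal ((1 + 2 * a) / (1 - a) ^ 2 - 1) := by
  have ha0 : 0 ≤ a := (abs_nonneg _).trans hle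
  have hZ : 1 - a ≤ ∫ z, f z ^ β ∂μ := by linarith [(abs_le.1 hle).1]
  have hnum : ∫ z, f z ^ (2 * β - 1) ∂μ ≤ 1 + 2 * a := by linarith [(abs_le.1 hle').2]
  have ha' : 0 < 1 - a := sub_pos.2 ha
  rw [chiSqDiv_escort hf hf1 hβ hβ' (ha'.trans_le hZ).ne']
  gcongr

section Family

variable {ι : Type*} {p : ι → X → ℝ} {C : Set ι}

theorem exists_integral_le_of_iSup_lintegral_lt_top (hpm : ∀ i ∈ C, AEStronglyMeasurable (p i) μ)
    (hp : ∀ i ∈ C, 0 ≤ p i) (hfin : ⨆ i ∈ C, ∫⁻ z, ENNReal.ofReal (p i z) ∂μ < ∞) :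
    ∃ B, ∀ i ∈ C, Integrable (p i) μ ∧ ∫ z, p i z ∂μ ≤ B := by
  refine ⟨(⨆ i ∈ C, ∫⁻ z, ENNReal.ofReal (p i z) ∂μ).toReal, fun i hi => ?_⟩
  have hle : ∫⁻ z, ENNReal.ofReal (p i z) ∂μ ≤ ⨆ i ∈ C, ∫⁻ z, ENNReal.ofReal (p i z) ∂μ :=
    le_iSup₂_of_le i hi le_rfl
  refine ⟨(lintegral_ofReal_ne_top_iff_integrable (hpm i hi) (.of_forall (hp i hi))).1
    (hle.trans_lt hfin).ne, ?_⟩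
  rw [integral_eq_lintegral_of_nonneg_ae (.of_forall (hp i hi)) (hpm i hi)]
  exact ENNReal.toReal_mono hfin.ne hle

theorem exists_abs_integral_rpow_sub_one_le (hp : ∀ i ∈ C, ∀ z, 0 < p i z)
    (hp1 : ∀ i ∈ C, ∫ z, p i z ∂μ = 1) (hε : 0 < ε)
    (hplus : ⨆ i ∈ C, ∫⁻ z, ENNReal.ofReal (p i z ^ (1 + ε)) ∂μ < ∞)
    (hminus : ⨆ i ∈ C, ∫⁻ z, ENNReal.ofReal (p i z ^ (1 - ε)) ∂μ < ∞) :
    ∃ c, ∀ i ∈ C, ∀ α, |α - 1| ≤ ε → Integrable (fun z => p i z ^ α) μ ∧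
      |∫ z, p i z ^ α ∂μ - 1| ≤ |α - 1| * c := by
  have hpi : ∀ i ∈ C, Integrable (p i) μ :=
    fun i hi => .of_integral_ne_zero (hp1 i hi ▸ one_ne_zero)
  have hbound : ∀ a : ℝ, ⨆ i ∈ C, ∫⁻ z, ENNReal.ofReal (p i z ^ a) ∂μ < ∞ →
      ∃ B, ∀ i ∈ C, Integrable (fun z => p i z ^ a) μ ∧ ∫ z, p i z ^ a ∂μ ≤ B := fun a =>
    exists_integral_le_of_iSup_lintegral_lt_top
      (fun i hi => ((hpi i hi).aemeasurable.pow_const a).aestronglyMeasurable)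
      (fun i hi z => Real.rpow_nonneg (hp i hi z).le a)
  obtain ⟨B, hB⟩ := hbound _ hplus
  obtain ⟨B', hB'⟩ := hbound _ hminus
  refine ⟨(B + B') / ε, fun i hi α hα => ⟨integrable_rpow_of_abs_sub_one_le (hp i hi) (hpi i hi)
    hε (hB i hi).1 (hB' i hi).1 hα, ?_⟩⟩
  calc |∫ z, p i z ^ α ∂μ - 1|
      ≤ |α - 1| / ε * (∫ z, p i z ^ (1 + ε) ∂μ + ∫ z, p i z ^ (1 - ε) ∂μ) := hp1 i hi ▸
        abs_integral_rpow_sub_integral_le (hp i hi) (hpi i hi) hε (hB i hi).1 (hB' i hi).1 hα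
    _ ≤ |α - 1| / ε * (B + B') := by gcongr; exacts [(hB i hi).2, (hB' i hi).2]
    _ = |α - 1| * ((B + B') / ε) := by ring

theorem tendsto_iSup_chiSqDiv_escort (hp : ∀ i ∈ C, ∀ z, 0 < p i z)
    (hp1 : ∀ i ∈ C, ∫ z, p i z ∂μ = 1) (hε : 0 < ε)
    (hplus : ⨆ i ∈ C, ∫⁻ z, ENNReal.ofReal (p i z ^ (1 + ε)) ∂μ < ∞)
    (hminus : ⨆ i ∈ C, ∫⁻ z, ENNReal.ofReal (p i z ^ (1 - ε)) ∂μ < ∞)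
    {κ : Type*} {l : Filter κ} {β : κ → ℝ} (hβ : Tendsto β l (𝓝 1)) :
    Tendsto (fun n => ⨆ i ∈ C, chiSqDiv μ (escort μ (β n) (p i)) (p i)) l (𝓝 0) := by
  obtain ⟨c, hc⟩ := exists_abs_integral_rpow_sub_one_le hp hp1 hε hplus hminus
  have hβ0 : Tendsto (fun n => |β n - 1|) l (𝓝 0) := by simpa using (hβ.sub_const 1).abs
  have hβc : Tendsto (fun n => |β n - 1| * c) l (𝓝 0) := by simpa using hβ0.mul_const c
  have hlim : Tendsto (fun n => ENNReal.ofReal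
      ((1 + 2 * (|β n - 1| * c)) / (1 - |β n - 1| * c) ^ 2 - 1)) l (𝓝 0) := by
    have hcont : ContinuousAt (fun a : ℝ => (1 + 2 * a) / (1 - a) ^ 2 - 1) 0 := by
      fun_prop (disch := norm_num)
    simpa using ENNReal.tendsto_ofReal (hcont.tendsto.comp hβc)
  refine tendsto_of_tendsto_of_tendsto_of_le_of_le' tendsto_const_nhds hlim
    (.of_forall fun _ => zero_le) ?_
  filter_upwards [hβ0.eventually_le_const (half_pos hε), hβc.eventually_lt_const one_pos]
    with n hn hn1
  refine iSup₂_le fun i hi => ?_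
  have hdouble : |2 * β n - 1 - 1| = 2 * |β n - 1| := by
    rw [show 2 * β n - 1 - 1 = 2 * (β n - 1) by ring, abs_mul, abs_two]
  obtain ⟨hint, hle⟩ := hc i hi (β n) (by linarith)
  obtain ⟨hint', hle'⟩ := hc i hi (2 * β n - 1) (by linarith)
  rw [hdouble, mul_assoc] at hle'
  exact chiSqDiv_escort_le (hp i hi) (hp1 i hi) hint hint' hn1 hle hle'

end Family

theorem aestronglyMeasurable_of_smul {E : Type*} [NormedAddCommGroup E] [NormedSpace ℝ E]
    {p : X → ℝ} {S : X → E} (hp : ∀ z, p z ≠ 0) (hpm : AEMeasurable p μ)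
    (hpS : AEStronglyMeasurable (fun z => p z • S z) μ) : AEStronglyMeasurable S μ :=
  (hpm.inv.aestronglyMeasurable.smul hpS).congr
    (.of_forall fun z => inv_smul_smul₀ (hp z) (S z))

theorem ofReal_mul_sqrt_rpow_two {a d : ℝ} (ha : 0 ≤ a) (hd : 0 ≤ d) :
    ENNReal.ofReal (a * √d) ^ (2 : ℝ) = ENNReal.ofReal (a ^ 2 * d) := by
  rw [ENNReal.ofReal_rpow_of_nonneg (by positivity) zero_le_two, Real.rpow_two, mul_pow,
    Real.sq_sqrt hd]

theorem enorm_integral_smul_sub_le_chiSqDiv {E : Type*} [NormedAddCommGroup E] [NormedSpace ℝ E]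
    {r p : X → ℝ} {S : X → E} (hp : ∀ z, 0 < p z) (hpm : AEMeasurable p μ) (hrm : AEMeasurable r μ)
    (hrS : Integrable (fun z => r z • S z) μ) (hpS : Integrable (fun z => p z • S z) μ) :
    ‖∫ z, r z • S z ∂μ - ∫ z, p z • S z ∂μ‖ₑ ≤
      (∫⁻ z, ENNReal.ofReal (‖S z‖ ^ 2 * p z) ∂μ) ^ (1 / 2 : ℝ) *
        chiSqDiv μ r p ^ (1 / 2 : ℝ) := by
  have hSm := (aestronglyMeasurable_of_smul (fun z => (hp z).ne') hpm hpS.1).norm.aemeasurable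
  have hpointwise : ∀ z, ‖r z • S z - p z • S z‖ₑ =
      ENNReal.ofReal (‖S z‖ * √(p z)) * ENNReal.ofReal (|r z / p z - 1| * √(p z)) := by
    intro z
    have hz := hp z
    have hsplit : r z - p z = (r z / p z - 1) * (√(p z) * √(p z)) := by
      rw [Real.mul_self_sqrt hz.le]; field_simp
    rw [← ENNReal.ofReal_mul (by positivity), ← sub_smul, hsplit, ← ofReal_norm, norm_smul,
      Real.norm_eq_abs, abs_mul, abs_mul_self]
    ring_nf
  rw [← integral_sub hrS hpS]
  refine (enorm_integral_le_lintegral_enorm _).trans ?_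
  have hCS := ENNReal.lintegral_mul_le_Lp_mul_Lq μ Real.HolderConjugate.two_two
    (f := fun z => ENNReal.ofReal (‖S z‖ * √(p z)))
    (g := fun z => ENNReal.ofReal (|r z / p z - 1| * √(p z)))
    (by fun_prop) (by fun_prop)
  simpa only [chiSqDiv, Pi.mul_apply, ← hpointwise,
    ofReal_mul_sqrt_rpow_two (norm_nonneg _) (hp _).le,
    ofReal_mul_sqrt_rpow_two (abs_nonneg _) (hp _).le, sq_abs] using hCS

end Escort

namespace ExpModel

variable {l q : ℕ} {X : Type*} [MeasurableSpace X] {M : ExpModel l q X}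

/-- The integrals of `p_θ^(1 ± ε)` are bounded on compact subsets of `Θ`, for some `ε > 0` which may
depend on the compact set. By convexity this controls all exponents in between. -/
def LocallyBoundedPowers (M : ExpModel l q X) : Prop :=
  ∀ C ⊆ M.Θ, IsCompact C → ∃ ε : ℝ, 0 < ε ∧
    ⨆ θ ∈ C, ∫⁻ z, ENNReal.ofReal (M.dens θ z ^ (1 + ε)) ∂M.μ < ∞ ∧
    ⨆ θ ∈ C, ∫⁻ z, ENNReal.ofReal (M.dens θ z ^ (1 - ε)) ∂M.μ < ∞

/-- The second moment of the statistic `S` under `p_θ` is bounded on compact subsets of `Θ`. -/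
def LocallyBoundedSecondMoment (M : ExpModel l q X) : Prop :=
  ∀ C ⊆ M.Θ, IsCompact C → ⨆ θ ∈ C, ∫⁻ z, ENNReal.ofReal (‖M.S z‖ ^ 2 * M.dens θ z) ∂M.μ < ∞

theorem TemperingCond.locallyBoundedPowers (hα : M.TemperingCond) : M.LocallyBoundedPowers := by
  intro C hCΘ hC
  obtain ⟨ε, hε, hbound⟩ := hα C hCΘ hC
  exact ⟨ε, hε, (hbound (1 + ε) (by simp [abs_of_pos hε])).1,
    (hbound (1 - ε) (by simp [abs_of_pos hε])).1⟩

theorem ofReal_norm_sq_mul {n : ℕ} (s : EuclideanSpace ℝ (Fin n)) {d : ℝ} (hd : 0 ≤ d) :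
    ENNReal.ofReal (‖s‖ ^ 2 * d) = ∑ u, ENNReal.ofReal (s u ^ 2 * d) := by
  rw [EuclideanSpace.real_norm_sq_eq, Finset.sum_mul,
    ENNReal.ofReal_sum_of_nonneg fun u _ => mul_nonneg (sq_nonneg _) hd]

theorem TemperingCond.locallyBoundedSecondMoment (hα : M.TemperingCond)
    (hg : ∀ θ ∈ M.Θ, 0 < M.g θ)
    (hS : ∀ θ ∈ M.Θ, Integrable (fun z => M.dens θ z • M.S z) M.μ) :
    M.LocallyBoundedSecondMoment := by
  intro C hCΘ hC
  obtain ⟨ε, hε, hbound⟩ := hα C hCΘ hC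
  have hcoord := (hbound 1 (Metric.mem_closedBall_self hε.le)).2
  simp only [Real.rpow_one] at hcoord
  refine lt_of_le_of_lt (iSup₂_le fun θ hθ => ?_)
    (ENNReal.sum_lt_top.2 fun u (_ : u ∈ Finset.univ) => hcoord u)
  have hgθ := hg θ (hCΘ hθ)
  have hdm := (integrable_dens hgθ).aemeasurable
  have hSm := (aestronglyMeasurable_of_smul (fun z => (dens_pos hgθ z).ne') hdm
    (hS θ (hCΘ hθ)).1).aemeasurable
  simp only [ofReal_norm_sq_mul _ (dens_pos hgθ _).le]
  rw [lintegral_finsetSum' _ fun u _ => by fun_prop]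
  exact Finset.sum_le_sum fun u _ => le_iSup₂_of_le θ hθ le_rfl

theorem tendsto_iSup_chiSqDiv_temperedDens (hg : ∀ θ ∈ M.Θ, 0 < M.g θ)
    (hpow : M.LocallyBoundedPowers) {C : Set (EuclideanSpace ℝ (Fin l))} (hCΘ : C ⊆ M.Θ)
    (hC : IsCompact C) {κ : Type*} {U : Filter κ} {T : κ → ℝ} (hT : Tendsto T U (𝓝 1)) :
    Tendsto (fun n => ⨆ θ ∈ C, chiSqDiv M.μ (M.temperedDens (T n) θ) (M.dens θ)) U (𝓝 0) := by
  obtain ⟨ε, hε, hplus, hminus⟩ := hpow C hCΘ hC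
  have hβ : Tendsto (fun n => 1 / T n) U (𝓝 1) := by
    simpa using hT.inv₀ one_ne_zero
  exact tendsto_iSup_chiSqDiv_escort (fun θ hθ => dens_pos (hg θ (hCΘ hθ)))
    (fun θ hθ => integral_dens (hg θ (hCΘ hθ))) hε hplus hminus hβ

theorem enorm_temperedS_sub_Sbar_le {θ : EuclideanSpace ℝ (Fin l)} {T : ℝ} (hg : 0 < M.g θ)
    (hS : Integrable (fun z => M.dens θ z • M.S z) M.μ)
    (hTS : Integrable (fun z => M.temperedDens T θ z • M.S z) M.μ) :
    ‖M.temperedS T θ - M.Sbar θ‖ₑ ≤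
      (∫⁻ z, ENNReal.ofReal (‖M.S z‖ ^ 2 * M.dens θ z) ∂M.μ) ^ (1 / 2 : ℝ) *
        chiSqDiv M.μ (M.temperedDens T θ) (M.dens θ) ^ (1 / 2 : ℝ) :=
  have hdm := (integrable_dens hg).aemeasurable
  enorm_integral_smul_sub_le_chiSqDiv (dens_pos hg) hdm ((hdm.pow_const _).div_const _) hTS hS

theorem tendsto_temperedS_sub_Sbar (hg : ∀ θ ∈ M.Θ, 0 < M.g θ)
    (hS : ∀ θ ∈ M.Θ, Integrable (fun z => M.dens θ z • M.S z) M.μ)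
    (hpow : M.LocallyBoundedPowers) (hmom : M.LocallyBoundedSecondMoment)
    {C : Set (EuclideanSpace ℝ (Fin l))} (hCΘ : C ⊆ M.Θ) (hC : IsCompact C) {κ : Type*}
    {U : Filter κ} {T : κ → ℝ} (hT : Tendsto T U (𝓝 1)) {t : κ → EuclideanSpace ℝ (Fin l)}
    (ht : ∀ᶠ n in U, t n ∈ C)
    (hTS : ∀ᶠ n in U, Integrable (fun z => M.temperedDens (T n) (t n) z • M.S z) M.μ) :
    Tendsto (fun n => M.temperedS (T n) (t n) - M.Sbar (t n)) U (𝓝 0) := by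
  set B := ⨆ θ ∈ C, ∫⁻ z, ENNReal.ofReal (‖M.S z‖ ^ 2 * M.dens θ z) ∂M.μ
  have hB : B ^ (1 / 2 : ℝ) ≠ ∞ :=
    ENNReal.rpow_ne_top_of_nonneg (by norm_num) (hmom C hCΘ hC).ne
  have hχ := tendsto_iSup_chiSqDiv_temperedDens hg hpow hCΘ hC hT
  have hlim := ENNReal.Tendsto.const_mul (hχ.ennrpow_const (1 / 2 : ℝ)) (.inr hB)
  rw [ENNReal.zero_rpow_of_pos (by norm_num), mul_zero] at hlim
  refine tendsto_zero_iff_enorm_tendsto_zero.2 <|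
    tendsto_of_tendsto_of_tendsto_of_le_of_le' tendsto_const_nhds hlim
      (.of_forall fun _ => zero_le) ?_
  filter_upwards [ht, hTS] with n hn hint
  refine (enorm_temperedS_sub_Sbar_le (hg _ (hCΘ hn)) (hS _ (hCΘ hn)) hint).trans ?_
  gcongr
  · exact le_iSup₂_of_le (t n) hn le_rfl
  · exact le_iSup₂_of_le (t n) hn le_rfl

theorem CondM2.tracksMap_tempered {θhat : EuclideanSpace ℝ (Fin q) → EuclideanSpace ℝ (Fin l)}
    (hM2 : M.CondM2 θhat) (hpow : M.LocallyBoundedPowers) (hmom : M.LocallyBoundedSecondMoment)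
    {T : ℕ → ℝ} (hT : Tendsto T atTop (𝓝 1)) {θ : ℕ → EuclideanSpace ℝ (Fin l)}
    (hθ : ∀ n, θ n ∈ M.Θ) (hdef : ∀ n, M.TemperedStepDefined (T n) (θ n)) :
    TracksMap M.Θ (fun t => θhat (M.Sbar t)) θ fun n => θhat (M.temperedS (T n) (θ n)) := by
  intro x hx
  set U : Filter ℕ := atTop ⊓ comap θ (𝓝 x)
  have hθx : Tendsto θ U (𝓝[M.Θ] x) :=
    tendsto_nhdsWithin_iff.2 ⟨tendsto_comap.mono_left inf_le_right, .of_forall hθ⟩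
  have hgx := hM2.g_pos x hx
  have hlevel : ∀ᶠ n in U, θ n ∈ {t ∈ M.Θ | M.g x / 2 ≤ M.g t} :=
    (((hM2.continuousOn_g x hx).tendsto.comp hθx).eventually_const_le (half_lt_self hgx)).mono
      fun n hn => ⟨hθ n, hn⟩
  have hdiff := tendsto_temperedS_sub_Sbar hM2.g_pos hM2.integrable_Sbar hpow hmom (sep_subset _ _)
    (hM2.isCompact_level _ (half_pos hgx)) (hT.mono_left inf_le_left) hlevel
    (.of_forall fun n => (hdef n).integrable_stat)
  have hSbar : Tendsto (fun n => M.temperedS (T n) (θ n)) U (𝓝 (M.Sbar x)) := by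
    simpa using hdiff.add ((hM2.continuousOn_Sbar x hx).tendsto.comp hθx)
  exact (hM2.continuousOn_θhat _ (hM2.Sbar_mem x hx)).tendsto.comp
    (tendsto_nhdsWithin_iff.2 ⟨hSbar, .of_forall fun n => (hdef n).mem_Sdom⟩)

end ExpModel

theorem mainTheorem2_general {l q : ℕ} {X : Type*} [MeasurableSpace X] (M : ExpModel l q X)
    (θhat : EuclideanSpace ℝ (Fin q) → EuclideanSpace ℝ (Fin l)) (hM2 : M.CondM2 θhat)
    (hlevel : ∀ t ∈ M.Θ, ∃ c, 0 < c ∧ c ≤ M.g t ∧ c ∉ M.g '' M.statPoints θhat)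
    (hpow : M.LocallyBoundedPowers) (hmom : M.LocallyBoundedSecondMoment)
    (T : ℕ → ℝ) (hT : Tendsto T atTop (𝓝 1)) :
    (∀ C ⊆ M.Θ, IsCompact C → Tendsto
      (fun n => ⨆ θ ∈ C, chiSqDiv M.μ (M.temperedDens (T n) θ) (M.dens θ)) atTop (𝓝 0)) ∧
    ∀ (K : ℕ → Set (EuclideanSpace ℝ (Fin l))) (θ : ℕ → EuclideanSpace ℝ (Fin l)) (p : ℕ → ℕ),
      IsCompactExhaustion M.Θ K →
      (∀ n, M.TemperedStepDefined (T n) (θ n)) →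
      IsStableIteration K (fun n t => θhat (M.temperedS (T n) t)) θ p →
      (limsup (fun n => (p n : ℕ∞)) atTop < ⊤ ∧
        IsCompact (closure (range θ)) ∧ closure (range θ) ⊆ M.Θ) ∧
      (∃ w ∈ M.g '' (M.statPoints θhat ∩ closure (range θ)),
        ConvergesToSet (fun n => M.g (θ n))
          (connectedComponentIn (M.g '' (M.statPoints θhat ∩ closure (range θ))) w)) ∧
      (interior (M.g '' (M.statPoints θhat ∩ closure (range θ))) = ∅ →
        ∃ w : ℝ, Tendsto (fun n => M.g (θ n)) atTop (𝓝 w) ∧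
          ConvergesToSet θ ({t ∈ M.statPoints θhat | M.g t = w} ∩ closure (range θ))) := by
  refine ⟨fun C hCΘ hC => ExpModel.tendsto_iSup_chiSqDiv_temperedDens hM2.g_pos hpow hCΘ hC hT,
    fun K θ p hK hdef hrun => ?_⟩
  have hKΘ : ∀ n, K n ⊆ M.Θ := fun n => hK.iUnion_eq ▸ subset_iUnion K n
  have hθ : ∀ n, θ n ∈ M.Θ := fun n => hKΘ _ (hrun.mem_truncation hK.monotone n)
  have htrack := hM2.tracksMap_tempered hpow hmom hT hθ hdef
  obtain ⟨c, hc0, hcg, hc⟩ := hlevel (θ 0) (hθ 0)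
  have hacc := hM2.isAscentMap.eventually_accept hK hrun htrack
    (fun n => hM2.mapsTo_θhat (hdef n).mem_Sdom) (hM2.isCompact_level c hc0) hc hcg
  obtain ⟨P, hP⟩ := hrun.exists_count_le hacc
  have hcl := hrun.closure_range_subset hK hP
  have hcomp := (hK.isCompact P).of_isClosed_subset isClosed_closure hcl
  have hclΘ := hcl.trans (hKΘ P)
  have htrack' := htrack.congr' (hacc.mono fun n hn => (hrun.accept n hn).1.symm)
  have hsub := hM2.isAscentMap.limitInterval_subset htrack' hcomp hclΘ
  have hgcomp := hcomp.image_of_continuousOn (hM2.continuousOn_g.mono hclΘ)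
  have hgmem : ∀ n, M.g (θ n) ∈ M.g '' closure (range θ) := fun n =>
    mem_image_of_mem _ (subset_closure (mem_range_self n))
  refine ⟨⟨limsup_natCast_lt_top hP, hcomp, hclΘ⟩,
    exists_convergesToSet_connectedComponentIn hgcomp hgmem hsub, fun hint => ?_⟩
  obtain ⟨w, hw⟩ := exists_tendsto_of_interior_eq_empty hgcomp hgmem hsub hint
  exact ⟨w, hw, hM2.isAscentMap.convergesToSet htrack' hcomp hclΘ hw⟩

theorem mainTheorem2 {l q : ℕ} {X : Type*} [MeasurableSpace X] (M : ExpModel l q X)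
    (θhat : EuclideanSpace ℝ (Fin q) → EuclideanSpace ℝ (Fin l))
    (hM1 : M.CondM1) (hM2 : M.CondM2 θhat) (hM3 : M.CondM3 θhat)
    (hα : M.TemperingCond)
    (T : ℕ → ℝ) (hTpos : ∀ n, 0 < T n) (hT : Tendsto T atTop (𝓝 1)) :
    -- the tempered density is close to the exact one, uniformly on compact sets
    (∀ C ⊆ M.Θ, IsCompact C →
      Tendsto (fun n => ⨆ θ ∈ C, ∫⁻ z, ENNReal.ofReal
        ((M.temperedDens (T n) θ z / M.dens θ z - 1) ^ 2 * M.dens θ z) ∂M.μ) atTop (𝓝 0)) ∧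
    -- every run of the stabilised tempered EM converges
    ∀ (K : ℕ → Set (EuclideanSpace ℝ (Fin l))) (θ : ℕ → EuclideanSpace ℝ (Fin l)) (p : ℕ → ℕ),
      IsCompactExhaustion M.Θ K →
      (∀ n, M.TemperedStepDefined (T n) (θ n)) →
      IsStableIteration K (fun n t => θhat (M.temperedS (T n) t)) θ p →
      -- (i)(a)
      (limsup (fun n => (p n : ℕ∞)) atTop < ⊤ ∧
        IsCompact (closure (range θ)) ∧ closure (range θ) ⊆ M.Θ) ∧
      -- (i)(b)
      (∃ w ∈ M.g '' (M.statPoints θhat ∩ closure (range θ)),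
        ConvergesToSet (fun n => M.g (θ n))
          (connectedComponentIn (M.g '' (M.statPoints θhat ∩ closure (range θ))) w)) ∧
      -- (ii)
      (interior (M.g '' (M.statPoints θhat ∩ closure (range θ))) = ∅ →
        ∃ w : ℝ, Tendsto (fun n => M.g (θ n)) atTop (𝓝 w) ∧
          ConvergesToSet θ ({t ∈ M.statPoints θhat | M.g t = w} ∩ closure (range θ))) :=
  mainTheorem2_general M θhat hM2 (fun _ => hM2.exists_level_notMem hM3) hα.locallyBoundedPowers
    (hα.locallyBoundedSecondMoment hM2.g_pos hM2.integrable_Sbar) T hT
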